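/- **Proposition 3.7.** Let $(\Omega,\mathcal F,\{\mathcal F_t\}_{t\ge0},\{\theta_t\}_{t\ge0},\{M_t\}_{t\ge0},\{\mathbb P^x\}_{x\in\mathbb R^d})$ be a conservative time-homogeneous Markov process (in the sense of Blumenthal and Getoor) with càdlàg sample paths and state space $(\mathbb R^d,\mathcal B(\mathbb R^d))$, with transition kernel $p(t,x,dy)=\mathbb P^x(M_t\in dy)$ and semigroup acting on measures by $\mu P_t=\int p(t,x,dy)\,\mu(dx)$. Let $\{S_t\}_{t\ge0}$ be a subordinator with characteristic exponent $\phi$, independent of $\{M_t\}_{t\ge0}$; that is, under every $\mathbb P^x$, $\{S_t\}_{t\ge0}$ is a nondecreasing Lévy process in $[0,\infty)$ with $\mathbb E^x[e^{-uS_t}]=e^{-t\phi(u)}$ for all $u>0$, $t\ge0$, and is independent of $\{M_t\}_{t\ge0}$. Let $M^\phi_t:=M_{S_t}$, $t\ge0$, be the subordinate process, and let $\delta_xP^\phi_t$ denote the law of $M^\phi_t$ under $\mathbb P^x$. Let $\rho$ be a metric on $\mathbb R^d$ such that $(\mathbb R^d,\rho)$ is a Polish space and its Borel $\sigma$-algebra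 is contained in $\mathcal B(\mathbb R^d)$. For $p\ge1$ and probability measures $\mu,\nu$ on $\mathcal B(\mathbb R^d)$ let $$\mathcal W_{\rho,p}(\mu,\nu):=\inf_{\Pi}\left(\int_{\mathbb R^d\times\mathbb R^d}\rho(y,z)^p\,\Pi(dy,dz)\right)^{1/p}\in[0,\infty],$$ where the infimum runs over all couplings $\Pi$ of $\mu$ and $\nu$. Let $p\ge1$, and suppose that $\{M_t\}_{t\ge0}$ admits an invariant probability measure $\pi$ (that is, $\pi P_t=\pi$ for all $t\ge0$) such that $$\mathcal W_{\rho,p}(\delta_xP_t,\pi)\le\Gamma(x)\,r(t),\qquad t\ge0,\ x\in\mathbb R^d,$$ where $r:[0,\infty)\to[1,\infty)$ is Borel measurable and $\Gamma:\mathbb R^d\to[0,\infty)$. Then $$\mathcal W_{\rho,p}(\delta_xP^\phi_t,\pi)\le\Gamma(x)\,r_\phi(t),\qquad t\ge0,\ x\in\mathbb R^d,$$ where $r_\phi(t)=\left(\mathbb E[r(S_t)^p]\right)^{1/p}\in[1,\infty]$, the expectation being the same under every $\mathbb P^y$, $y\in\mathbb R^d$, and $0\cdot\infty=0$. -/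

import Mathlib

open MeasureTheory ProbabilityTheory Filter Topology
open scoped NNReal ENNReal

namespace Subordination

/-- A càdlàg function of time: right-continuous, with left limits. -/
def IsCadlag {X : Type*} [TopologicalSpace X] (f : ℝ≥0 → X) : Prop :=
  ∀ t : ℝ≥0, ContinuousWithinAt f (Set.Ici t) t ∧ ∃ l : X, Tendsto f (𝓝[<] t) (𝓝 l)

/-- `(Ω, ℱ, (ℱ t), (θ t), (M t), (P x))` is a (conservative, time-homogeneous) Markov process with
state space `X`, with translation operators and (almost surely) càdlàg sample paths, in the sense
of Blumenthal and Getoor. As there, normality `P x (M 0 = x) = 1` is not part of the definition: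
processes started at `x` under `P x` are covered. -/
structure IsMarkovProcess {Ω X : Type*} {mΩ : MeasurableSpace Ω} [TopologicalSpace X]
    [MeasurableSpace X] (ℱ : Filtration ℝ≥0 mΩ) (θ : ℝ≥0 → Ω → Ω) (M : ℝ≥0 → Ω → X)
    (P : X → Measure Ω) : Prop where
  /-- no cemetery: the `P x` are probability measures, and `M` takes all its values in `X` -/
  isProbabilityMeasure : ∀ x, IsProbabilityMeasure (P x)
  adapted : ∀ t, Measurable[ℱ t] (M t)
  cadlag : ∀ x, ∀ᵐ ω ∂(P x), IsCadlag (fun t => M t ω)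
  measurable_prob : ∀ (t : ℝ≥0) (B : Set X), MeasurableSet B →
    Measurable (fun x => P x (M t ⁻¹' B))
  /-- homogeneity: `M_s ∘ θ_t = M_{t+s}` -/
  shift : ∀ s t ω, M s (θ t ω) = M (t + s) ω
  /-- Markov property: `P^x(M_{t+s} ∈ B | ℱ_t) = P^{M_t}(M_s ∈ B)`, `P^x`-almost surely -/
  markov : ∀ (x : X) (s t : ℝ≥0) (B : Set X), MeasurableSet B →
    (P x)[(M (t + s) ⁻¹' B).indicator (fun _ => (1 : ℝ)) | ℱ t]
      =ᵐ[P x] fun ω => (P (M t ω)).real (M s ⁻¹' B)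

/-- The transition kernel `p(t, x, dy) = P^x(M_t ∈ dy)`. -/
noncomputable def transitionKernel {Ω X : Type*} [MeasurableSpace Ω] [MeasurableSpace X]
    (M : ℝ≥0 → Ω → X) (P : X → Measure Ω) (t : ℝ≥0) (x : X) : Measure X :=
  (P x).map (M t)

/-- The action `μ P_t = ∫ p(t, x, dy) μ(dx)` of the semigroup on measures. -/
noncomputable def semigroupAct {Ω X : Type*} [MeasurableSpace Ω] [MeasurableSpace X]
    (M : ℝ≥0 → Ω → X) (P : X → Measure Ω) (μ : Measure X) (t : ℝ≥0) : Measure X :=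
  μ.bind (transitionKernel M P t)

/-- `π` is invariant: `π P_t = π` for all `t ≥ 0`. -/
def IsInvariant {Ω X : Type*} [MeasurableSpace Ω] [MeasurableSpace X]
    (M : ℝ≥0 → Ω → X) (P : X → Measure Ω) (π : Measure X) : Prop :=
  ∀ t, semigroupAct M P π t = π

/-- `S` is, under `Q`, a subordinator with characteristic (Laplace) exponent `φ` (only the values
`φ u`, `u > 0`, matter): a Lévy process with nondecreasing paths in `[0, ∞)` and
`E[exp (-u S_t)] = exp (-t φ(u))`. Left limits of the paths exist by monotonicity. -/
structure IsSubordinator {Ω : Type*} [MeasurableSpace Ω] (Q : Measure Ω) (S : ℝ≥0 → Ω → ℝ≥0)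
    (φ : ℝ → ℝ) : Prop where
  measurable : ∀ t, Measurable (S t)
  zero : ∀ᵐ ω ∂Q, S 0 ω = 0
  monotone : ∀ᵐ ω ∂Q, Monotone (fun t => S t ω)
  rightCont : ∀ᵐ ω ∂Q, ∀ t, ContinuousWithinAt (fun s => S s ω) (Set.Ici t) t
  indepIncrements : HasIndepIncrements (fun t ω => (S t ω : ℝ)) Q
  stationaryIncrements : ∀ s t : ℝ≥0,
    IdentDistrib (fun ω => (S (s + t) ω : ℝ) - (S s ω : ℝ)) (fun ω => (S t ω : ℝ)) Q Q
  laplace : ∀ u : ℝ, 0 < u → ∀ t : ℝ≥0,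
    ∫ ω, Real.exp (-u * (S t ω : ℝ)) ∂Q = Real.exp (-(t : ℝ) * φ u)

/-- The subordinate process `M^φ_t = M_{S_t}`. -/
def subordinate {Ω X : Type*} (M : ℝ≥0 → Ω → X) (S : ℝ≥0 → Ω → ℝ≥0) : ℝ≥0 → Ω → X :=
  fun t ω => M (S t ω) ω

/-- `ρ` is a metric on `X` whose topology is Polish and whose Borel sets are measurable in `X`. -/
def IsPolishMetric {X : Type*} [MeasurableSpace X] (ρ : X → X → ℝ) : Prop :=
  ∃ m : MetricSpace X, (∀ x y, @dist X m.toDist x y = ρ x y) ∧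
    @PolishSpace X m.toUniformSpace.toTopologicalSpace ∧
    @borel X m.toUniformSpace.toTopologicalSpace ≤ (inferInstance : MeasurableSpace X)

/-- `γ` is a coupling of `μ` and `ν`. -/
def IsCoupling {X : Type*} [MeasurableSpace X] (μ ν : Measure X) (γ : Measure (X × X)) : Prop :=
  IsProbabilityMeasure γ ∧ γ.map Prod.fst = μ ∧ γ.map Prod.snd = ν

/-- The (possibly infinite) `L^p`-Wasserstein distance with respect to the metric `ρ`. -/
noncomputable def wasserstein {X : Type*} [MeasurableSpace X] (ρ : X → X → ℝ) (p : ℝ)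
    (μ ν : Measure X) : ℝ≥0∞ :=
  ⨅ (γ : Measure (X × X)) (_ : IsCoupling μ ν γ),
    (∫⁻ z, ENNReal.ofReal (ρ z.1 z.2) ^ p ∂γ) ^ (1 / p)

end Subordination

/-! Since `S` is independent of `M`, the law of `M_{S_t}` under `P x` is the mixture of the laws of
`M_s` with weights `P x (S_t ∈ ds)`. The `p`-th power of the Wasserstein distance to a fixed measure
is convex along mixtures, so it is at most the average of `(Γ(x) r(S_t))^p`; the `p`-th root gives
`Γ(x) r_φ(t)`.

Convexity is usually proved by choosing near-optimal couplings measurably in the mixing parameter.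
Here no selection is made. Cutting the space into finitely many small cells turns couplings into
matrices, and the achievable pairs (first marginal, cost bound) form a closed convex set, which is
stable under averaging (`exists_transport_integral`). The averaged matrix lifts to a coupling
(`exists_coupling_of_matrix`), with an error controlled in `exists_coupling_bind_truncCost_le`.
Prokhorov's theorem and Fatou's lemma remove the error (`exists_coupling_bind_lintegral_le`).

The mixture formula rests on recovering a right-continuous path measurably from a countable time
grid (`exists_kernel_map_eval_indep`). Uniqueness of Laplace transforms makes `r_φ` independent of
the starting point (`IsSubordinator.map_eq`). -/

namespace Subordination

/-! ### Finite optimal transport and lifting of matrices to couplings -/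

open scoped Pointwise in
/-- Convexity of the finite optimal transport cost in one marginal, in integral form. -/
theorem exists_transport_integral {ι T : Type*} [Fintype ι] [MeasurableSpace T]
    (μ : Measure T) [IsProbabilityMeasure μ] (c : ι → ι → ℝ) (b : ι → ℝ)
    (a : T → ι → ℝ) (V : T → ℝ) (ha : Integrable a μ) (hV : Integrable V μ)
    (h : ∀ t, ∀ ε : ℝ, 0 < ε → ∃ g : ι → ι → ℝ, (∀ i j, 0 ≤ g i j) ∧
      (∀ i, ∑ j, g i j = a t i) ∧ (∀ j, ∑ i, g i j = b j) ∧
      ∑ i, ∑ j, c i j * g i j ≤ V t + ε) :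
    ∃ g : ι → ι → ℝ, (∀ i j, 0 ≤ g i j) ∧
      (∀ i, ∑ j, g i j = ∫ t, a t i ∂μ) ∧ (∀ j, ∑ i, g i j = b j) ∧
      ∑ i, ∑ j, c i j * g i j ≤ ∫ t, V t ∂μ := by
  classical
  let K : Set (ι → ι → ℝ) := {g | (∀ i j, 0 ≤ g i j) ∧ ∀ j, ∑ i, g i j = b j}
  let L : (ι → ι → ℝ) →ₗ[ℝ] (ι → ℝ) × ℝ :=
    { toFun := fun g => (fun i => ∑ j, g i j, ∑ i, ∑ j, c i j * g i j)
      map_add' := fun g g' => by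
        ext <;> simp [Finset.sum_add_distrib, mul_add]
      map_smul' := fun k g => by
        ext <;> simp [Finset.mul_sum, mul_left_comm] }
  have hLc : Continuous L := L.continuous_of_finiteDimensional
  have hKclosed : IsClosed K := by
    have : K = (⋂ i, ⋂ j, {g | 0 ≤ g i j}) ∩ ⋂ j, {g | ∑ i, g i j = b j} := by
      ext g; simp [K]
    rw [this]
    refine IsClosed.inter (isClosed_iInter fun i => isClosed_iInter fun j => ?_)
      (isClosed_iInter fun j => ?_)
    · exact isClosed_le (by fun_prop) (by fun_prop)
    · exact isClosed_eq (by fun_prop) (by fun_prop)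
  have hKcompact : IsCompact K := by
    refine (isCompact_Icc (a := (0 : ι → ι → ℝ)) (b := fun _ j => b j)).of_isClosed_subset
      hKclosed fun g hg => ⟨fun i j => hg.1 i j, fun i j => ?_⟩
    change g i j ≤ b j
    rw [← hg.2 j]
    exact Finset.single_le_sum (f := fun i => g i j) (fun i _ => hg.1 i j) (Finset.mem_univ i)
  have hKconvex : Convex ℝ K := by
    intro g hg g' hg' s t hs ht hst
    refine ⟨fun i j => ?_, fun j => ?_⟩
    · have h1 := hg.1 i j
      have h2 := hg'.1 i j
      simp only [Pi.add_apply, Pi.smul_apply, smul_eq_mul]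
      positivity
    · simp only [Pi.add_apply, Pi.smul_apply, smul_eq_mul, Finset.sum_add_distrib,
        ← Finset.mul_sum, hg.2 j, hg'.2 j]
      rw [← add_mul, hst, one_mul]
  -- The epigraph of the optimal cost as a function of the first marginal. It is closed because `K`
  -- is compact, being confined to a box by the column sums.
  let s : Set ((ι → ℝ) × ℝ) := L '' K + {(0 : ι → ℝ)} ×ˢ Set.Ici (0 : ℝ)
  have hsclosed : IsClosed s :=
    IsClosed.add_left_of_isCompact (isClosed_singleton.prod isClosed_Ici) (hKcompact.image hLc)
  have hsconvex : Convex ℝ s :=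
    (hKconvex.linear_image L).add ((convex_singleton _).prod (convex_Ici _))
  have mem_s (x : ι → ℝ) (v : ℝ) : (x, v) ∈ s ↔ ∃ g : ι → ι → ℝ, (∀ i j, 0 ≤ g i j) ∧
      (∀ i, ∑ j, g i j = x i) ∧ (∀ j, ∑ i, g i j = b j) ∧
      ∑ i, ∑ j, c i j * g i j ≤ v := by
    constructor
    · rintro ⟨_, ⟨g, hg, rfl⟩, ⟨y, w⟩, ⟨hy, hw⟩, hsum⟩
      have h1 := congrArg Prod.fst hsum
      have h2 := congrArg Prod.snd hsum
      simp only [Set.mem_singleton_iff] at hy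
      subst hy
      refine ⟨g, hg.1, fun i => ?_, hg.2, ?_⟩
      · simpa [L] using congrFun h1 i
      · simp only [Set.mem_Ici] at hw
        simp only [L, LinearMap.coe_mk, AddHom.coe_mk, Prod.snd_add] at h2
        linarith
    · rintro ⟨g, hg0, hrow, hcol, hcost⟩
      refine ⟨L g, ⟨g, ⟨hg0, hcol⟩, rfl⟩, (0, v - ∑ i, ∑ j, c i j * g i j), ⟨rfl, ?_⟩, ?_⟩
      · simpa using hcost
      · ext <;> simp [L, hrow]
  have hmem (t : T) : (a t, V t) ∈ s := by
    have hlim : Tendsto (fun ε : ℝ => (a t, V t + ε)) (𝓝[>] 0) (𝓝 (a t, V t)) := by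
      have : Continuous fun ε : ℝ => (a t, V t + ε) := by fun_prop
      have := this.tendsto 0
      simp only [add_zero] at this
      exact this.mono_left nhdsWithin_le_nhds
    refine hsclosed.mem_of_tendsto hlim ?_
    filter_upwards [self_mem_nhdsWithin] with ε hε
    exact (mem_s _ _).2 (h t ε hε)
  -- Jensen's inequality in set form: the mean of a function with values in a closed convex set
  -- stays in the set.
  have hint := hsconvex.integral_mem hsclosed (Eventually.of_forall hmem) (ha.prodMk hV)
  rw [integral_pair ha hV, mem_s] at hint
  obtain ⟨g, h0, h1, h2, h3⟩ := hint
  exact ⟨g, h0, fun i => by rw [h1, eval_integral (fun i => ha.eval i)], h2, h3⟩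

/-- A matrix whose row and column sums are the cell masses of two probability measures lifts to a
coupling of these measures. -/
theorem exists_coupling_of_matrix {X ι : Type*} [MeasurableSpace X] [Fintype ι] [MeasurableSpace ι]
    [MeasurableSingletonClass ι] (q : X → ι) (hq : Measurable q)
    (ν π : Measure X) [IsProbabilityMeasure ν] [IsProbabilityMeasure π]
    (g : ι → ι → ℝ≥0∞)
    (hrow : ∀ i, ∑ j, g i j = ν (q ⁻¹' {i})) (hcol : ∀ j, ∑ i, g i j = π (q ⁻¹' {j})) :
    ∃ γ : Measure (X × X), IsCoupling ν π γ ∧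
      ∀ i j, γ ((q ⁻¹' {i}) ×ˢ (q ⁻¹' {j})) = g i j := by
  classical
  have hm (i : ι) : MeasurableSet (q ⁻¹' {i}) := hq (measurableSet_singleton i)
  have hg1 (i j) : g i j ≤ ν (q ⁻¹' {i}) := by
    rw [← hrow i]
    exact Finset.single_le_sum (f := fun j => g i j) (fun _ _ => zero_le) (Finset.mem_univ j)
  have hg2 (i j) : g i j ≤ π (q ⁻¹' {j}) := by
    rw [← hcol j]
    exact Finset.single_le_sum (f := fun i => g i j) (fun _ _ => zero_le) (Finset.mem_univ i)
  -- A null cell forces the entry `g i j` to vanish, so the division is harmless there.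
  have hcancel (i j) : g i j / (ν (q ⁻¹' {i}) * π (q ⁻¹' {j})) *
      (ν (q ⁻¹' {i}) * π (q ⁻¹' {j})) = g i j := by
    refine ENNReal.div_mul_cancel' (fun h => ?_) (fun h => ?_)
    · rcases mul_eq_zero.1 h with h | h
      · exact le_antisymm (h ▸ hg1 i j) zero_le
      · exact le_antisymm (h ▸ hg2 i j) zero_le
    · exact absurd h (ENNReal.mul_ne_top (measure_ne_top _ _) (measure_ne_top _ _))
  -- Within each product of cells the mass `g i j` is spread as the product of the two conditional
  -- measures.
  let γ : Measure (X × X) := ∑ i, ∑ j, (g i j / (ν (q ⁻¹' {i}) * π (q ⁻¹' {j}))) •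
    ((ν.restrict (q ⁻¹' {i})).prod (π.restrict (q ⁻¹' {j})))
  have hγ (A B : Set X) : γ (A ×ˢ B) = ∑ i, ∑ j, g i j / (ν (q ⁻¹' {i}) * π (q ⁻¹' {j})) *
      (ν.restrict (q ⁻¹' {i}) A * π.restrict (q ⁻¹' {j}) B) := by
    simp only [γ, Measure.coe_finsetSum, Finset.sum_apply, Measure.smul_apply,
      Measure.prod_prod, smul_eq_mul]
  have hfst : γ.map Prod.fst = ν := by
    ext A hA
    rw [Measure.map_apply measurable_fst hA, ← Set.prod_univ, hγ]
    have key (i j) : g i j / (ν (q ⁻¹' {i}) * π (q ⁻¹' {j})) *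
        (ν.restrict (q ⁻¹' {i}) A * π.restrict (q ⁻¹' {j}) Set.univ) =
        g i j * (ν.restrict (q ⁻¹' {i}) A / ν (q ⁻¹' {i})) := by
      rcases eq_or_ne (ν (q ⁻¹' {i})) 0 with h0 | h0
      · have : g i j = 0 := le_antisymm (h0 ▸ hg1 i j) zero_le
        simp [this]
      · conv_rhs => rw [← hcancel i j]
        rw [Measure.restrict_apply_univ, mul_assoc]
        congr 1
        rw [mul_right_comm, ENNReal.mul_div_cancel h0 (measure_ne_top _ _)]
    simp_rw [key, ← Finset.sum_mul, hrow]
    have key2 (i) : ν (q ⁻¹' {i}) * (ν.restrict (q ⁻¹' {i}) A / ν (q ⁻¹' {i})) =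
        ν (A ∩ q ⁻¹' {i}) := by
      rw [Measure.restrict_apply hA]
      refine ENNReal.mul_div_cancel' (fun h => measure_mono_null Set.inter_subset_right h)
        (fun h => absurd h (measure_ne_top _ _))
    simp_rw [key2]
    rw [← measure_biUnion_finset (fun i _ j _ hij => ?_) (fun i _ => hA.inter (hm i))]
    · congr 1; ext x; simp
    · exact Set.disjoint_left.2 fun x hx hy => hij (hx.2.symm.trans hy.2)
  have hsnd : γ.map Prod.snd = π := by
    ext A hA
    rw [Measure.map_apply measurable_snd hA, ← Set.univ_prod, hγ]
    have key (i j) : g i j / (ν (q ⁻¹' {i}) * π (q ⁻¹' {j})) *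
        (ν.restrict (q ⁻¹' {i}) Set.univ * π.restrict (q ⁻¹' {j}) A) =
        g i j * (π.restrict (q ⁻¹' {j}) A / π (q ⁻¹' {j})) := by
      rcases eq_or_ne (π (q ⁻¹' {j})) 0 with h0 | h0
      · have : g i j = 0 := le_antisymm (h0 ▸ hg2 i j) zero_le
        simp [this]
      · conv_rhs => rw [← hcancel i j]
        rw [Measure.restrict_apply_univ, mul_assoc]
        congr 1
        rw [mul_assoc, ENNReal.mul_div_cancel h0 (measure_ne_top _ _)]
    simp_rw [key]
    rw [Finset.sum_comm]
    simp_rw [← Finset.sum_mul, hcol]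
    have key2 (i) : π (q ⁻¹' {i}) * (π.restrict (q ⁻¹' {i}) A / π (q ⁻¹' {i})) =
        π (A ∩ q ⁻¹' {i}) := by
      rw [Measure.restrict_apply hA]
      refine ENNReal.mul_div_cancel' (fun h => measure_mono_null Set.inter_subset_right h)
        (fun h => absurd h (measure_ne_top _ _))
    simp_rw [key2]
    rw [← measure_biUnion_finset (fun i _ j _ hij => ?_) (fun i _ => hA.inter (hm i))]
    · congr 1; ext x; simp
    · exact Set.disjoint_left.2 fun x hx hy => hij (hx.2.symm.trans hy.2)
  refine ⟨γ, ⟨⟨?_⟩, hfst, hsnd⟩, fun i j => ?_⟩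
  · rw [← Set.preimage_univ (f := Prod.fst), ← Measure.map_apply measurable_fst .univ, hfst,
      measure_univ]
  · rw [hγ, Finset.sum_eq_single i, Finset.sum_eq_single j]
    · rw [Measure.restrict_apply_self, Measure.restrict_apply_self, hcancel]
    · intro j' _ hj'
      rw [Measure.restrict_apply (hm j), ← Set.preimage_inter,
        Set.singleton_inter_eq_empty.2 (by simpa using hj'.symm)]
      simp
    · simp
    · intro i' _ hi'
      refine Finset.sum_eq_zero fun j' _ => ?_
      rw [Measure.restrict_apply (hm i), ← Set.preimage_inter,
        Set.singleton_inter_eq_empty.2 (by simpa using hi'.symm)]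
      simp
    · simp

/-! ### Convexity of the transport cost on a Polish space -/

/-- A separable metric space has a finite measurable partition into cells close to given points,
apart from a last cell of small measure. -/
theorem exists_measurable_partition {X : Type*} [MetricSpace X] [SecondCountableTopology X]
    [Nonempty X] [MeasurableSpace X] [OpensMeasurableSpace X] (ν : Measure X) [IsFiniteMeasure ν]
    {δ : ℝ≥0} (hδ : 0 < δ) {η : ℝ≥0∞} (hη : 0 < η) :
    ∃ (n : ℕ) (q : X → Fin (n + 1)) (z : Fin (n + 1) → X), Measurable q ∧
      (∀ x, q x ≠ Fin.last n → nndist x (z (q x)) ≤ δ) ∧ ν (q ⁻¹' {Fin.last n}) ≤ η := by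
  classical
  let u := TopologicalSpace.denseSeq X
  have hex (x : X) : ∃ k, nndist x (u k) < δ := by
    obtain ⟨k, hy⟩ := (TopologicalSpace.denseRange_denseSeq X).exists_dist_lt x
      (NNReal.coe_pos.2 hδ)
    exact ⟨k, hy⟩
  let f : X → ℕ := fun x => Nat.find (hex x)
  have hf : Measurable f := measurable_find hex fun k =>
    measurableSet_lt (measurable_id.nndist measurable_const) measurable_const
  have hlim : Tendsto (fun n => ν (f ⁻¹' Set.Ici n)) atTop (𝓝 0) := by
    have := tendsto_measure_iInter_atTop (μ := ν) (s := fun n => f ⁻¹' Set.Ici n)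
      (fun n => (hf measurableSet_Ici).nullMeasurableSet)
      (fun a b hab => Set.preimage_mono (Set.Ici_subset_Ici.2 hab)) ⟨0, measure_ne_top _ _⟩
    have h0 : ⋂ n, f ⁻¹' Set.Ici n = ∅ := by
      ext x
      simp only [Set.mem_iInter, Set.mem_preimage, Set.mem_Ici, Set.mem_empty_iff_false, iff_false]
      exact fun h => absurd (h (f x + 1)) (by omega)
    rw [h0, measure_empty] at this
    exact this
  obtain ⟨n, hn⟩ := (hlim.eventually (Iic_mem_nhds hη)).exists
  -- Points are sorted by the first dense point within `δ`; all indices from `n` on share the last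
  -- cell, whose centre carries no information.
  refine ⟨n, fun x => ⟨min (f x) n, by omega⟩, fun i => u i,
    (measurable_of_countable fun k : ℕ => (⟨min k n, by omega⟩ : Fin (n + 1))).comp hf,
    fun x hx => ?_, ?_⟩
  · have hlt : f x < n := by
      by_contra hcon
      exact hx (Fin.ext (by simp only [Fin.val_last]; omega))
    simp only [min_eq_left hlt.le]
    exact (Nat.find_spec (hex x)).le
  · refine (measure_mono fun x hx => ?_).trans hn
    have := congrArg Fin.val (Set.mem_singleton_iff.1 hx)
    simp only [Fin.val_last] at this
    change n ≤ f x
    omega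

/-- Lower approximation of the cost `dist ^ p`, bounded and continuous. -/
noncomputable def truncCost {X : Type*} [MetricSpace X] (p : ℝ) (N δ : ℝ≥0) (z : X × X) : ℝ≥0 :=
  min N ((nndist z.1 z.2 - 4 * δ) ^ p)

theorem truncCost_anti {X : Type*} [MetricSpace X] {p : ℝ} (hp : 0 ≤ p) (N : ℝ≥0) {δ δ' : ℝ≥0}
    (h : δ ≤ δ') (z : X × X) : truncCost p N δ' z ≤ truncCost p N δ z := by
  unfold truncCost
  gcongr

theorem continuous_truncCost {X : Type*} [MetricSpace X] {p : ℝ} (hp : 0 ≤ p) (N δ : ℝ≥0) :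
    Continuous (truncCost p N δ : X × X → ℝ≥0) := by
  have := (NNReal.continuous_rpow_const hp).comp
    ((continuous_nndist (α := X)).sub (continuous_const (y := 4 * δ)))
  exact continuous_const.min this

/-- The mixture of measures each at bounded transport cost from `π` is, up to truncation of the
cost, at the averaged transport cost from `π`. -/
theorem exists_coupling_bind_truncCost_le {X T : Type*} [MetricSpace X]
    [SecondCountableTopology X] [MeasurableSpace X] [BorelSpace X] [MeasurableSpace T]
    (μ : Measure T) [IsProbabilityMeasure μ] (κ : Kernel T X) [IsMarkovKernel κ]
    (π : Measure X) [IsProbabilityMeasure π] {p : ℝ} (hp : 0 ≤ p)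
    (F : T → ℝ) (hF0 : ∀ t, 0 ≤ F t) (hF : Integrable F μ)
    (h : ∀ t, ∀ ε : ℝ, 0 < ε → ∃ γ, IsCoupling (κ t) π γ ∧
      ∫⁻ z, (nndist z.1 z.2 : ℝ≥0∞) ^ p ∂γ ≤ ENNReal.ofReal (F t + ε))
    {δ : ℝ≥0} (hδ : 0 < δ) :
    ∃ γ, IsCoupling (μ.bind κ) π γ ∧ ∀ N : ℝ≥0,
      ∫⁻ z, truncCost p N δ z ∂γ ≤ ENNReal.ofReal (∫ t, F t ∂μ) + N * δ := by
  classical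
  have : Nonempty X := nonempty_of_isProbabilityMeasure π
  set ν := μ.bind κ with hν
  obtain ⟨n, q, w, hq, hw, hbad⟩ := exists_measurable_partition (ν + π) hδ
    (ENNReal.coe_pos.2 hδ)
  have hcell (i) : MeasurableSet (q ⁻¹' {i}) := hq (measurableSet_singleton i)
  -- Moving both points to their centres changes the distance by at most `2 * δ`; subtracting this
  -- and ignoring the last cell keeps `c` below the true cost.
  let c : Fin (n + 1) → Fin (n + 1) → ℝ≥0 := fun i j =>
    if i = Fin.last n ∨ j = Fin.last n then 0 else (nndist (w i) (w j) - 2 * δ) ^ p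
  have hc_le (x y : X) : c (q x) (q y) ≤ nndist x y ^ p := by
    simp only [c]
    split_ifs with hxy
    · exact zero_le
    · push Not at hxy
      gcongr
      rw [tsub_le_iff_right]
      calc nndist (w (q x)) (w (q y)) ≤ nndist (w (q x)) x + nndist x (w (q y)) :=
            nndist_triangle _ _ _
        _ ≤ nndist (w (q x)) x + (nndist x y + nndist y (w (q y))) := by
            gcongr; exact nndist_triangle _ _ _
        _ ≤ δ + (nndist x y + δ) := by
            gcongr
            · rw [nndist_comm]; exact hw x hxy.1
            · exact hw y hxy.2
        _ = nndist x y + 2 * δ := by ring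
  -- The `4 * δ` in `truncCost` is the `2 * δ` subtracted in `c` plus `2 * δ` for returning from the
  -- centres. On the last cell the truncation level `N` pays.
  have hle_c (N : ℝ≥0) (x y : X) : truncCost p N δ (x, y) ≤ c (q x) (q y) +
      ((q ⁻¹' {Fin.last n}).indicator (fun _ => N) x +
        (q ⁻¹' {Fin.last n}).indicator (fun _ => N) y) := by
    by_cases hx : q x = Fin.last n
    · refine (min_le_left _ _).trans ?_
      rw [Set.indicator_of_mem (by simpa using hx)]
      exact le_add_left (le_add_right le_rfl)
    by_cases hy : q y = Fin.last n
    · refine (min_le_left _ _).trans ?_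
      rw [Set.indicator_of_mem (a := y) (by simpa using hy)]
      exact le_add_left (le_add_left le_rfl)
    refine (min_le_right _ _).trans (le_add_right ?_)
    simp only [c, hx, hy, or_self, if_false]
    gcongr ?_ ^ p
    rw [tsub_le_iff_right]
    calc nndist x y ≤ nndist x (w (q x)) + nndist (w (q x)) y := nndist_triangle _ _ _
      _ ≤ nndist x (w (q x)) + (nndist (w (q x)) (w (q y)) + nndist (w (q y)) y) := by
          gcongr; exact nndist_triangle _ _ _
      _ ≤ δ + ((nndist (w (q x)) (w (q y)) - 2 * δ + 2 * δ) + δ) := by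
          gcongr
          · exact hw x hx
          · exact le_tsub_add
          · rw [nndist_comm]; exact hw y hy
      _ = nndist (w (q x)) (w (q y)) - 2 * δ + 4 * δ := by ring
  -- the cost of a coupling in terms of the cells
  have hcost (γ : Measure (X × X)) : ∫⁻ z, (c (q z.1) (q z.2) : ℝ≥0∞) ∂γ =
      ∑ i, ∑ j, (c i j : ℝ≥0∞) * γ ((q ⁻¹' {i}) ×ˢ (q ⁻¹' {j})) := by
    have hqq : Measurable fun z : X × X => (q z.1, q z.2) := by fun_prop
    rw [← lintegral_map (f := fun ij : Fin (n + 1) × Fin (n + 1) => (c ij.1 ij.2 : ℝ≥0∞))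
      (measurable_of_countable _) hqq, lintegral_fintype, Fintype.sum_prod_type]
    refine Finset.sum_congr rfl fun i _ => Finset.sum_congr rfl fun j _ => ?_
    rw [Measure.map_apply hqq (measurableSet_singleton _)]
    congr 2
    ext z
    simp [Prod.ext_iff]
  have hrows {α β γ} (hγ : IsCoupling α β γ) (i) :
      ∑ j, γ ((q ⁻¹' {i}) ×ˢ (q ⁻¹' {j})) = α (q ⁻¹' {i}) := by
    rw [← hγ.2.1, Measure.map_apply measurable_fst (hcell i),
      ← measure_biUnion_finset (fun j _ j' _ hjj => ?_) (fun j _ => (hcell i).prod (hcell j))]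
    · congr 1; ext z; simp
    · exact Set.disjoint_left.2 fun x hx hy => hjj (hx.2.symm.trans hy.2)
  have hcols {α β γ} (hγ : IsCoupling α β γ) (j) :
      ∑ i, γ ((q ⁻¹' {i}) ×ˢ (q ⁻¹' {j})) = β (q ⁻¹' {j}) := by
    rw [← hγ.2.2, Measure.map_apply measurable_snd (hcell j),
      ← measure_biUnion_finset (fun i _ i' _ hii => ?_) (fun i _ => (hcell i).prod (hcell j))]
    · congr 1; ext z; simp
    · exact Set.disjoint_left.2 fun x hx hy => hii (hx.1.symm.trans hy.1)
  have ha (i) : Measurable fun t => (κ t).real (q ⁻¹' {i}) :=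
    (κ.measurable_coe (hcell i)).ennreal_toReal
  obtain ⟨g, hg0, hgrow, hgcol, hgcost⟩ := exists_transport_integral μ
    (fun i j => (c i j : ℝ)) (fun j => π.real (q ⁻¹' {j}))
    (fun t i => (κ t).real (q ⁻¹' {i})) F
    (Integrable.of_eval fun i => Integrable.of_bound (ha i).aestronglyMeasurable 1
      (Eventually.of_forall fun t => by
        rw [Real.norm_of_nonneg measureReal_nonneg]; exact measureReal_le_one))
    hF fun t ε hε => by
      obtain ⟨γ, hγ, hγle⟩ := h t ε hε
      have := hγ.1
      refine ⟨fun i j => γ.real ((q ⁻¹' {i}) ×ˢ (q ⁻¹' {j})), fun _ _ => measureReal_nonneg,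
        fun i => ?_, fun j => ?_, ?_⟩
      · simp only [Measure.real]
        rw [← hrows hγ i, ENNReal.toReal_sum fun _ _ => measure_ne_top _ _]
      · simp only [Measure.real]
        rw [← hcols hγ j, ENNReal.toReal_sum fun _ _ => measure_ne_top _ _]
      · have h1 : ∑ i, ∑ j, (c i j : ℝ≥0∞) * γ ((q ⁻¹' {i}) ×ˢ (q ⁻¹' {j})) ≤
            ENNReal.ofReal (F t + ε) := by
          rw [← hcost]
          refine (lintegral_mono fun z => ?_).trans hγle
          rw [← ENNReal.coe_rpow_of_nonneg _ hp]
          exact ENNReal.coe_le_coe.2 (hc_le z.1 z.2)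
        have h2 := ENNReal.toReal_mono ENNReal.ofReal_ne_top h1
        rw [ENNReal.toReal_sum fun _ _ => ENNReal.sum_ne_top.2 fun _ _ =>
          ENNReal.mul_ne_top ENNReal.coe_ne_top (measure_ne_top _ _)] at h2
        simp_rw [ENNReal.toReal_sum fun (_ : Fin (n + 1)) _ =>
          ENNReal.mul_ne_top ENNReal.coe_ne_top (measure_ne_top γ _),
          ENNReal.toReal_mul, ENNReal.coe_toReal] at h2
        rwa [ENNReal.toReal_ofReal (add_nonneg (hF0 t) hε.le)] at h2
  have hνreal (i) : ∫ t, (κ t).real (q ⁻¹' {i}) ∂μ = ν.real (q ⁻¹' {i}) := by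
    simp only [Measure.real]
    rw [integral_toReal (κ.measurable_coe (hcell i)).aemeasurable
      (Eventually.of_forall fun t => measure_lt_top _ _), hν,
      Measure.bind_apply (hcell i) κ.measurable.aemeasurable]
  obtain ⟨γ, hγ, hγcell⟩ := exists_coupling_of_matrix q hq ν π (fun i j => ENNReal.ofReal (g i j))
    (fun i => by
      rw [← ENNReal.ofReal_sum_of_nonneg fun j _ => hg0 i j, hgrow, hνreal, ofReal_measureReal])
    (fun j => by
      rw [← ENNReal.ofReal_sum_of_nonneg fun i _ => hg0 i j, hgcol, ofReal_measureReal])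
  refine ⟨γ, hγ, fun N => ?_⟩
  have hcγ : ∫⁻ z, (c (q z.1) (q z.2) : ℝ≥0∞) ∂γ ≤ ENNReal.ofReal (∫ t, F t ∂μ) := by
    rw [hcost]
    refine le_trans (le_of_eq ?_) (ENNReal.ofReal_le_ofReal hgcost)
    rw [ENNReal.ofReal_sum_of_nonneg fun i _ => Finset.sum_nonneg fun j _ =>
      mul_nonneg (NNReal.coe_nonneg (c i j)) (hg0 i j)]
    refine Finset.sum_congr rfl fun i _ => ?_
    rw [ENNReal.ofReal_sum_of_nonneg fun j _ => mul_nonneg (NNReal.coe_nonneg (c i j)) (hg0 i j)]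
    refine Finset.sum_congr rfl fun j _ => ?_
    rw [hγcell, ENNReal.ofReal_mul (NNReal.coe_nonneg (c i j)), ENNReal.ofReal_coe_nnreal]
  have hb := hcell (Fin.last n)
  have hind : Measurable fun x => (((q ⁻¹' {Fin.last n}).indicator (fun _ => N) x : ℝ≥0) : ℝ≥0∞) :=
    (measurable_const.indicator hb).coe_nnreal_ennreal
  have hind1 : Measurable fun z : X × X =>
      (((q ⁻¹' {Fin.last n}).indicator (fun _ => N) z.1 : ℝ≥0) : ℝ≥0∞) := hind.comp measurable_fst
  have hind2 : Measurable fun z : X × X =>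
      (((q ⁻¹' {Fin.last n}).indicator (fun _ => N) z.2 : ℝ≥0) : ℝ≥0∞) := hind.comp measurable_snd
  have hind12 : Measurable fun z : X × X =>
      (((q ⁻¹' {Fin.last n}).indicator (fun _ => N) z.1 : ℝ≥0) : ℝ≥0∞) +
        (((q ⁻¹' {Fin.last n}).indicator (fun _ => N) z.2 : ℝ≥0) : ℝ≥0∞) := hind1.add hind2
  have hindint (α : Measure X) :
      ∫⁻ x, (((q ⁻¹' {Fin.last n}).indicator (fun _ => N) x : ℝ≥0) : ℝ≥0∞) ∂α =
        N * α (q ⁻¹' {Fin.last n}) := by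
    simp_rw [ENNReal.coe_indicator]
    rw [lintegral_indicator_const hb]
  calc ∫⁻ z, truncCost p N δ z ∂γ
      ≤ ∫⁻ z, ((c (q z.1) (q z.2) : ℝ≥0∞) +
        ((((q ⁻¹' {Fin.last n}).indicator (fun _ => N) z.1 : ℝ≥0) : ℝ≥0∞) +
        (((q ⁻¹' {Fin.last n}).indicator (fun _ => N) z.2 : ℝ≥0) : ℝ≥0∞))) ∂γ :=
        lintegral_mono fun z =>
          (ENNReal.coe_le_coe.2 (hle_c N z.1 z.2)).trans_eq (by push_cast; rfl)
    _ = ∫⁻ z, (c (q z.1) (q z.2) : ℝ≥0∞) ∂γ + (N * ν (q ⁻¹' {Fin.last n}) +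
        N * π (q ⁻¹' {Fin.last n})) := by
        rw [lintegral_add_right _ hind12,
          lintegral_add_right _ hind2, ← hindint ν, ← hindint π,
          ← lintegral_map hind measurable_fst, ← lintegral_map hind measurable_snd,
          hγ.2.1, hγ.2.2]
    _ ≤ _ := by
        rw [← mul_add, ← Measure.add_apply]
        gcongr

/-- The mixture of measures each at bounded transport cost from `π` is at the averaged transport
cost from `π`. -/
theorem exists_coupling_bind_lintegral_le {X T : Type*} [MetricSpace X]
    [PolishSpace X] [MeasurableSpace X] [BorelSpace X] [MeasurableSpace T]
    (μ : Measure T) [IsProbabilityMeasure μ] (κ : Kernel T X) [IsMarkovKernel κ]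
    (π : Measure X) [IsProbabilityMeasure π] {p : ℝ} (hp : 0 ≤ p)
    (F : T → ℝ) (hF0 : ∀ t, 0 ≤ F t) (hF : Integrable F μ)
    (h : ∀ t, ∀ ε : ℝ, 0 < ε → ∃ γ, IsCoupling (κ t) π γ ∧
      ∫⁻ z, (nndist z.1 z.2 : ℝ≥0∞) ^ p ∂γ ≤ ENNReal.ofReal (F t + ε)) :
    ∃ γ, IsCoupling (μ.bind κ) π γ ∧
      ∫⁻ z, (nndist z.1 z.2 : ℝ≥0∞) ^ p ∂γ ≤ ENNReal.ofReal (∫ t, F t ∂μ) := by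
  let δ : ℕ → ℝ≥0 := fun n => 1 / ((n : ℝ≥0) + 1)
  have hδ0 (n) : 0 < δ n := by positivity
  have hδanti : Antitone δ := fun m n hmn => by
    simp only [δ]; gcongr
  have hδlim : Tendsto δ atTop (𝓝 0) := tendsto_one_div_add_atTop_nhds_zero_nat
  choose γ hγ hγle using fun n => exists_coupling_bind_truncCost_le μ κ π hp F hF0 hF h (hδ0 n)
  let S : Set (ProbabilityMeasure (X × X)) := {γ | IsCoupling (μ.bind κ) π (γ : Measure (X × X))}
  -- Both marginals are fixed, and a single probability measure on a Polish space is tight;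
  -- Prokhorov's theorem then yields a limit along an ultrafilter.
  have hS : IsTightMeasureSet {((γ : ProbabilityMeasure (X × X)) : Measure (X × X)) | γ ∈ S} := by
    refine IsTightMeasureSet.prodMk
      ((isTightMeasureSet_singleton (μ := μ.bind κ)).subset ?_)
      ((isTightMeasureSet_singleton (μ := π)).subset ?_)
    · rintro _ ⟨_, ⟨γ, hγ, rfl⟩, rfl⟩; exact hγ.2.1
    · rintro _ ⟨_, ⟨γ, hγ, rfl⟩, rfl⟩; exact hγ.2.2
  let Γ : ℕ → ProbabilityMeasure (X × X) := fun n => ⟨γ n, (hγ n).1⟩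
  obtain ⟨γ', -, hγ'⟩ := (isCompact_closure_of_isTightMeasureSet hS).ultrafilter_le_nhds
    ((hyperfilter ℕ).map Γ) (le_principal_iff.2 (mem_map.2 (univ_mem' fun n =>
      subset_closure (hγ n))))
  have hlim : Tendsto Γ (hyperfilter ℕ : Filter ℕ) (𝓝 γ') := hγ'
  have hat : (hyperfilter ℕ : Filter ℕ) ≤ atTop := Nat.hyperfilter_le_atTop
  have hfst : (γ' : Measure (X × X)).map Prod.fst = μ.bind κ := by
    have h1 := ProbabilityMeasure.tendsto_map_of_tendsto_of_continuous _ _ hlim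
      (continuous_fst (X := X) (Y := X))
    have h2 (n) : (Γ n).map (continuous_fst (X := X) (Y := X)).measurable.aemeasurable =
      (⟨μ.bind κ, inferInstance⟩ : ProbabilityMeasure X) := Subtype.ext (hγ n).2.1
    simp_rw [h2] at h1
    exact congrArg (fun α : ProbabilityMeasure X => (α : Measure X))
      (tendsto_nhds_unique h1 tendsto_const_nhds)
  have hsnd : (γ' : Measure (X × X)).map Prod.snd = π := by
    have h1 := ProbabilityMeasure.tendsto_map_of_tendsto_of_continuous _ _ hlim
      (continuous_snd (X := X) (Y := X))
    have h2 (n) : (Γ n).map (continuous_snd (X := X) (Y := X)).measurable.aemeasurable =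
      (⟨π, inferInstance⟩ : ProbabilityMeasure X) := Subtype.ext (hγ n).2.2
    simp_rw [h2] at h1
    exact congrArg (fun α : ProbabilityMeasure X => (α : Measure X))
      (tendsto_nhds_unique h1 tendsto_const_nhds)
  refine ⟨γ', ⟨inferInstance, hfst, hsnd⟩, ?_⟩
  -- With `N` and `m` frozen the cost is bounded and continuous, so weak convergence applies; for `n
  -- ≥ m` it lies below the cost with `δ n`, and the error `N * δ n` vanishes.
  have hbound (N : ℝ≥0) (m : ℕ) : ∫⁻ z, truncCost p N (δ m) z ∂(γ' : Measure (X × X)) ≤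
      ENNReal.ofReal (∫ t, F t ∂μ) := by
    let f : BoundedContinuousFunction (X × X) ℝ≥0 :=
      BoundedContinuousFunction.mkOfBound ⟨truncCost p N (δ m), continuous_truncCost hp N (δ m)⟩ N
        fun x y => by
          rw [NNReal.dist_eq]
          exact abs_sub_le_of_nonneg_of_le (by positivity) (min_le_left _ _) (by positivity)
            (min_le_left _ _)
    have h1 := (ProbabilityMeasure.tendsto_iff_forall_lintegral_tendsto.1 hlim) f
    have h2 : Tendsto (fun n => ENNReal.ofReal (∫ t, F t ∂μ) + N * (δ n : ℝ≥0∞))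
        (hyperfilter ℕ : Filter ℕ) (𝓝 (ENNReal.ofReal (∫ t, F t ∂μ) + N * ((0 : ℝ≥0) : ℝ≥0∞))) :=
      tendsto_const_nhds.add (ENNReal.Tendsto.const_mul
        ((ENNReal.tendsto_coe.2 hδlim).mono_left hat) (Or.inr ENNReal.coe_ne_top))
    rw [ENNReal.coe_zero, mul_zero, add_zero] at h2
    refine le_of_tendsto_of_tendsto h1 h2 (hat ?_)
    filter_upwards [eventually_ge_atTop m] with n hn
    exact (lintegral_mono fun z => ENNReal.coe_le_coe.2
      (truncCost_anti hp N (hδanti hn) z)).trans (hγle n N)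
  have hpt (z : X × X) : Tendsto (fun m : ℕ => (truncCost p m (δ m) z : ℝ≥0∞)) atTop
      (𝓝 ((nndist z.1 z.2 : ℝ≥0∞) ^ p)) := by
    rw [← ENNReal.coe_rpow_of_nonneg _ hp, ENNReal.tendsto_coe]
    have h1 : Tendsto (fun m => (nndist z.1 z.2 - 4 * δ m) ^ p) atTop
        (𝓝 ((nndist z.1 z.2 - 4 * 0) ^ p)) :=
      ((NNReal.continuous_rpow_const hp).tendsto _).comp
        (tendsto_const_nhds.sub (hδlim.const_mul 4))
    rw [mul_zero, tsub_zero] at h1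
    refine h1.congr' ?_
    filter_upwards [eventually_ge_atTop ⌈nndist z.1 z.2 ^ p⌉₊] with m hm
    refine (min_eq_right ?_).symm
    calc (nndist z.1 z.2 - 4 * δ m) ^ p ≤ nndist z.1 z.2 ^ p := by
          gcongr; exact tsub_le_self
      _ ≤ m := Nat.ceil_le.1 hm
  -- Fatou's lemma along the diagonal `N = m`.
  calc ∫⁻ z, (nndist z.1 z.2 : ℝ≥0∞) ^ p ∂(γ' : Measure (X × X))
      = ∫⁻ z, liminf (fun m : ℕ => (truncCost p m (δ m) z : ℝ≥0∞)) atTop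
          ∂(γ' : Measure (X × X)) := lintegral_congr fun z => (hpt z).liminf_eq.symm
    _ ≤ liminf (fun m : ℕ => ∫⁻ z, (truncCost p m (δ m) z : ℝ≥0∞) ∂(γ' : Measure (X × X)))
          atTop := lintegral_liminf_le fun m =>
            (continuous_truncCost hp _ _).measurable.coe_nnreal_ennreal
    _ ≤ _ := by
      refine (liminf_le_liminf (Eventually.of_forall fun m : ℕ => hbound m m)).trans ?_
      exact (liminf_const _).le

/-! ### Convexity of the Wasserstein distance -/

/-- A countably separated `σ`-algebra contained in a standard Borel one is equal to it. -/
theorem eq_of_le_of_standardBorelSpace {X : Type*} {m₁ m₂ : MeasurableSpace X}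
    (h₁ : @StandardBorelSpace X m₁) (h₂ : @MeasurableSpace.CountablySeparated X m₂)
    (hle : m₂ ≤ m₁) : m₁ = m₂ := by
  refine le_antisymm (fun s hs => ?_) hle
  -- Lusin–Souslin: an injective measurable map from a standard Borel space to a countably separated
  -- one maps measurable sets to measurable sets.
  have e : @MeasurableEmbedding X X m₁ m₂ id :=
    @Measurable.measurableEmbedding X X m₂ id h₂ m₁ h₁ (fun s hs => hle s hs)
      Function.injective_id
  simpa using @MeasurableEmbedding.measurableSet_image' X X m₁ m₂ id e s hs

/-- The `L^p`-Wasserstein distance from a fixed measure, raised to the power `p`, is convex along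
mixtures. -/
theorem wasserstein_bind_le {X T : Type*} [MeasurableSpace X] [StandardBorelSpace X]
    [MeasurableSpace T] {ρ : X → X → ℝ} (hρ : IsPolishMetric ρ) {p : ℝ} (hp : 0 < p)
    (μ : Measure T) [IsProbabilityMeasure μ] (κ : Kernel T X) [IsMarkovKernel κ]
    (π : Measure X) [IsProbabilityMeasure π] (F : T → ℝ) (hF : Measurable F) (hF0 : ∀ t, 0 ≤ F t)
    (h : ∀ t, wasserstein ρ p (κ t) π ≤ ENNReal.ofReal (F t)) :
    wasserstein ρ p (μ.bind κ) π ≤ (∫⁻ t, ENNReal.ofReal (F t) ^ p ∂μ) ^ (1 / p) := by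
  rcases eq_or_ne (∫⁻ t, ENNReal.ofReal (F t) ^ p ∂μ) ⊤ with htop | htop
  · rw [htop, ENNReal.top_rpow_of_pos (by positivity)]
    exact le_top
  obtain ⟨m, hdist, hpolish, hborel⟩ := hρ
  let := m
  have : BorelSpace X := by
    have hsep : @MeasurableSpace.CountablySeparated X (borel X) := by
      let : MeasurableSpace X := borel X
      have : BorelSpace X := ⟨rfl⟩
      infer_instance
    exact ⟨eq_of_le_of_standardBorelSpace ‹_› hsep hborel⟩
  have hcost (γ : Measure (X × X)) : ∫⁻ z, ENNReal.ofReal (ρ z.1 z.2) ^ p ∂γ =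
      ∫⁻ z, (nndist z.1 z.2 : ℝ≥0∞) ^ p ∂γ :=
    lintegral_congr fun z => by rw [← hdist, ← edist_dist, edist_nndist]
  have hpow (t) : ENNReal.ofReal (F t) ^ p = ENNReal.ofReal (F t ^ p) :=
    ENNReal.ofReal_rpow_of_nonneg (hF0 t) hp.le
  simp_rw [hpow] at htop ⊢
  have hFp0 (t) : 0 ≤ F t ^ p := Real.rpow_nonneg (hF0 t) p
  have hint : Integrable (fun t => F t ^ p) μ :=
    (lintegral_ofReal_ne_top_iff_integrable (hF.pow_const p).aestronglyMeasurable
      (Eventually.of_forall hFp0)).1 htop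
  obtain ⟨γ, hγ, hγle⟩ := exists_coupling_bind_lintegral_le μ κ π hp.le (fun t => F t ^ p) hFp0
    hint fun t ε hε => by
      -- If every coupling cost more than `F t ^ p + ε`, the infimum could not be at most `F t`.
      by_contra! hcon
      have h1 : ENNReal.ofReal (F t ^ p + ε) ^ (1 / p) ≤ wasserstein ρ p (κ t) π := by
        refine le_iInf₂ fun γ hγ => ?_
        rw [hcost]
        exact ENNReal.rpow_le_rpow (hcon γ hγ).le (by positivity)
      have h2 := h1.trans (h t)
      rw [one_div, ENNReal.rpow_inv_le_iff hp, hpow,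
        ENNReal.ofReal_le_ofReal_iff (hFp0 t)] at h2
      linarith
  refine (iInf₂_le γ hγ).trans ?_
  rw [hcost, ← ofReal_integral_eq_lintegral_ofReal hint (Eventually.of_forall hFp0)]
  exact ENNReal.rpow_le_rpow hγle (by positivity)

/-! ### Evaluation of a path at an independent time -/

/-- A functional reconstructing a right-continuous path from its values on a countable set. -/
theorem exists_measurable_eval {X : Type*} [TopologicalSpace X] [PolishSpace X] [Nonempty X]
    [MeasurableSpace X] [BorelSpace X] :
    ∃ G : ℝ≥0 × (ℝ≥0 → X) → X, Measurable G ∧ ∀ w : ℝ≥0 → X,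
      (∀ t, ContinuousWithinAt w (Set.Ici t) t) → ∀ t, G (t, w) = w t := by
  -- The next point of the grid of mesh `1 / (n + 1)` to the right of `s`. Its countable range makes
  -- evaluation jointly measurable, and right-continuity gives convergence.
  let τ : ℕ → ℝ≥0 → ℝ≥0 := fun n s => (⌊((n : ℝ≥0) + 1) * s⌋₊ + 1) / ((n : ℝ≥0) + 1)
  let g : ℕ → ℝ≥0 × (ℝ≥0 → X) → X := fun n z => z.2 (τ n z.1)
  have hg (n) : Measurable (g n) := by
    have h1 : Measurable fun z : ℕ × (ℝ≥0 → X) => z.2 ((z.1 + 1 : ℝ≥0) / ((n : ℝ≥0) + 1)) :=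
      measurable_from_prod_countable_right fun k =>
        measurable_pi_apply ((k + 1 : ℝ≥0) / ((n : ℝ≥0) + 1))
    have h2 : Measurable fun z : ℝ≥0 × (ℝ≥0 → X) => (⌊((n : ℝ≥0) + 1) * z.1⌋₊, z.2) :=
      (Nat.measurable_floor.comp (measurable_fst.const_mul _)).prodMk measurable_snd
    exact h1.comp h2
  refine ⟨fun z => limUnder atTop fun n => g n z,
    (StronglyMeasurable.limUnder fun n => (hg n).stronglyMeasurable).measurable,
    fun w hw t => Tendsto.limUnder_eq ?_⟩
  have hle (n : ℕ) : t ≤ τ n t := by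
    rw [le_div_iff₀ (by positivity), mul_comm]
    exact (Nat.lt_floor_add_one _).le
  have hle' (n : ℕ) : τ n t ≤ t + 1 / ((n : ℝ≥0) + 1) := by
    simp only [τ]
    rw [add_div]
    gcongr
    rw [div_le_iff₀ (by positivity), mul_comm t]
    exact Nat.floor_le zero_le
  have hτ : Tendsto (fun n => τ n t) atTop (𝓝 t) := by
    refine tendsto_of_tendsto_of_tendsto_of_le_of_le tendsto_const_nhds ?_ hle hle'
    simpa using tendsto_const_nhds.add (tendsto_one_div_add_atTop_nhds_zero_nat (𝕜 := ℝ≥0))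
  exact (hw t).tendsto.comp (tendsto_nhdsWithin_iff.2 ⟨hτ, Eventually.of_forall hle⟩)

/-- The law of a right-continuous process evaluated at an independent random time. -/
theorem exists_kernel_map_eval_indep {Ω X : Type*} [MeasurableSpace Ω] [TopologicalSpace X]
    [PolishSpace X] [Nonempty X] [MeasurableSpace X] [BorelSpace X] (Q : Measure Ω)
    [IsProbabilityMeasure Q] (M : ℝ≥0 → Ω → X) (hM : ∀ t, Measurable (M t))
    (hcont : ∀ᵐ ω ∂Q, ∀ t, ContinuousWithinAt (fun s => M s ω) (Set.Ici t) t)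
    (S : Ω → ℝ≥0) (hS : Measurable S) (hind : IndepFun (fun ω t => M t ω) S Q) :
    ∃ κ : Kernel ℝ≥0 X, IsMarkovKernel κ ∧ (∀ s, κ s = Q.map (M s)) ∧
      Q.map (fun ω => M (S ω) ω) = (Q.map S).bind κ := by
  obtain ⟨G, hG, hGeval⟩ := exists_measurable_eval (X := X)
  have hpath : Measurable fun ω t => M t ω := measurable_pi_lambda _ hM
  set L := Q.map (fun ω t => M t ω) with hL
  have : IsProbabilityMeasure L := Measure.isProbabilityMeasure_map hpath.aemeasurable
  have hlaw (s : ℝ≥0) : (L.map (Prod.mk s)).map G = Q.map (M s) := by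
    rw [hL, Measure.map_map measurable_prodMk_left hpath,
      Measure.map_map hG (measurable_prodMk_left.comp hpath)]
    refine Measure.map_congr ?_
    filter_upwards [hcont] with ω hω
    exact hGeval _ hω s
  let κ : Kernel ℝ≥0 X :=
    { toFun := fun s => Q.map (M s)
      measurable' := by
        simp_rw [← hlaw]
        exact (Measure.measurable_map G hG).comp Measurable.map_prodMk_left }
  have hκ (s) : κ s = Q.map (M s) := rfl
  refine ⟨κ, ⟨fun s => Measure.isProbabilityMeasure_map (hM s).aemeasurable⟩, fun s => rfl, ?_⟩
  -- Independence enters here: time and path have a product joint law.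
  have h1 : Q.map (fun ω => M (S ω) ω) = ((Q.map S).prod L).map G := by
    rw [hL, ← (indepFun_iff_map_prod_eq_prod_map_map hS.aemeasurable hpath.aemeasurable).1 hind.symm,
      Measure.map_map hG (hS.prodMk hpath)]
    refine Measure.map_congr ?_
    filter_upwards [hcont] with ω hω
    exact (hGeval _ hω (S ω)).symm
  ext B hB
  rw [h1, Measure.map_apply hG hB, Measure.prod_apply (hG hB),
    Measure.bind_apply hB κ.measurable.aemeasurable]
  refine lintegral_congr fun s => ?_
  rw [hκ, ← hlaw, Measure.map_apply hG hB, Measure.map_apply measurable_prodMk_left (hG hB)]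

/-! ### Uniqueness of the law of a subordinator -/

/-- A probability measure on `[0, ∞)` is determined by its Laplace transform on the positive
half-line. -/
theorem ext_of_integral_exp_neg {P P' : Measure ℝ≥0} [IsProbabilityMeasure P]
    [IsProbabilityMeasure P']
    (h : ∀ u : ℝ, 0 < u → ∫ x, Real.exp (-u * (x : ℝ)) ∂P = ∫ x, Real.exp (-u * (x : ℝ)) ∂P') :
    P = P' := by
  have hc : Continuous fun x : ℝ≥0 => Real.exp (-(x : ℝ)) := by fun_prop
  let f : BoundedContinuousFunction ℝ≥0 ℝ := BoundedContinuousFunction.mkOfBound ⟨_, hc⟩ 1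
    fun x y => by
      rw [Real.dist_eq]
      exact abs_sub_le_of_nonneg_of_le (Real.exp_nonneg _) (by simp) (Real.exp_nonneg _) (by simp)
  have hf (x : ℝ≥0) : f x = Real.exp (-(x : ℝ)) := rfl
  -- Polynomials in `exp (-x)` separate points, and their integrals are combinations of Laplace
  -- transforms at natural numbers; the value at `0` is the total mass.
  let A : StarSubalgebra ℝ (BoundedContinuousFunction ℝ≥0 ℝ) :=
    { Algebra.adjoin ℝ {f} with
      star_mem' := fun {g} hg => by
        have : star g = g := by ext x; simp
        rwa [this] }
  refine ext_of_forall_mem_subalgebra_integral_eq_of_polish (𝕜 := ℝ) (A := A) ?_ ?_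
  · intro x y hxy
    refine ⟨f, ⟨BoundedContinuousFunction.toContinuousMapStarₐ ℝ f,
      ⟨f, Algebra.subset_adjoin rfl, rfl⟩, rfl⟩, ?_⟩
    rw [hf, hf]
    simpa using hxy
  · intro g hg
    change g ∈ Algebra.adjoin ℝ {f} at hg
    rw [Algebra.adjoin_singleton_eq_range_aeval] at hg
    obtain ⟨q, rfl⟩ := hg
    have hval (x : ℝ≥0) : (Polynomial.aeval f q) x =
        ∑ i ∈ q.support, q.coeff i * Real.exp (-(i : ℝ) * x) := by
      rw [Polynomial.aeval_def, Polynomial.eval₂_eq_sum, Polynomial.sum,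
        BoundedContinuousFunction.coe_sum, Finset.sum_apply]
      refine Finset.sum_congr rfl fun i _ => ?_
      rw [← Algebra.smul_def, BoundedContinuousFunction.coe_smul]
      change q.coeff i * (f ^ i) x = _
      rw [BoundedContinuousFunction.coe_pow, Pi.pow_apply, hf, ← Real.exp_nat_mul]
      ring_nf
    have hint (R : Measure ℝ≥0) [IsProbabilityMeasure R] (i : ℕ) :
        Integrable (fun x : ℝ≥0 => q.coeff i * Real.exp (-(i : ℝ) * x)) R := by
      refine (Integrable.of_bound (C := 1) (by fun_prop) (Eventually.of_forall fun x => ?_)).const_mul _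
      rw [Real.norm_of_nonneg (Real.exp_nonneg _), Real.exp_le_one_iff, neg_mul, neg_nonpos]
      positivity
    change ∫ x, (Polynomial.aeval f q) x ∂P = ∫ x, (Polynomial.aeval f q) x ∂P'
    simp_rw [hval]
    rw [integral_finsetSum _ fun i _ => hint P i, integral_finsetSum _ fun i _ => hint P' i]
    refine Finset.sum_congr rfl fun i _ => ?_
    rw [integral_const_mul, integral_const_mul]
    rcases Nat.eq_zero_or_pos i with rfl | hi
    · simp
    · rw [h i (Nat.cast_pos.2 hi)]

/-- The laws of a subordinator are determined by its characteristic exponent. -/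
theorem IsSubordinator.map_eq {Ω : Type*} [MeasurableSpace Ω] {Q Q' : Measure Ω}
    [IsProbabilityMeasure Q] [IsProbabilityMeasure Q'] {S : ℝ≥0 → Ω → ℝ≥0} {φ : ℝ → ℝ}
    (h : IsSubordinator Q S φ) (h' : IsSubordinator Q' S φ) (t : ℝ≥0) :
    Q.map (S t) = Q'.map (S t) := by
  have := Measure.isProbabilityMeasure_map (μ := Q) (h.measurable t).aemeasurable
  have := Measure.isProbabilityMeasure_map (μ := Q') (h.measurable t).aemeasurable
  refine ext_of_integral_exp_neg fun u hu => ?_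
  have hc : Continuous fun x : ℝ≥0 => Real.exp (-u * (x : ℝ)) := by fun_prop
  rw [integral_map (h.measurable t).aemeasurable hc.aestronglyMeasurable,
    integral_map (h.measurable t).aemeasurable hc.aestronglyMeasurable, h.laplace u hu,
    h'.laplace u hu]

/-- `Measure.bind` is meaningful only for a.e. measurable kernels. Under a Dirac mass any kernel is
a.e. constant, so no measurability in the starting point is needed, in particular none for the
subordinate process. -/
theorem semigroupAct_dirac {Ω X : Type*} [MeasurableSpace Ω] [MeasurableSpace X]
    [MeasurableSingletonClass X] (M : ℝ≥0 → Ω → X) (P : X → Measure Ω) (t : ℝ≥0) (x : X) :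
    semigroupAct M P (Measure.dirac x) t = (P x).map (M t) := by
  have h : transitionKernel M P t =ᵐ[Measure.dirac x] fun _ => (P x).map (M t) := by
    rw [Filter.EventuallyEq, ae_dirac_eq]
    exact eventually_pure.2 rfl
  rw [semigroupAct, Measure.bind_congr_right h, Measure.bind_const]
  simp

end Subordination

/-! ### The bound for the subordinate process -/

theorem proposition3p7 {d : ℕ} {Ω : Type*} {mΩ : MeasurableSpace Ω}
    (ℱ : Filtration ℝ≥0 mΩ) (θ : ℝ≥0 → Ω → Ω)
    (M : ℝ≥0 → Ω → EuclideanSpace ℝ (Fin d)) (P : EuclideanSpace ℝ (Fin d) → Measure Ω)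
    (hM : Subordination.IsMarkovProcess ℱ θ M P)
    (S : ℝ≥0 → Ω → ℝ≥0) (φ : ℝ → ℝ)
    (hS : ∀ x, Subordination.IsSubordinator (P x) S φ)
    (hMS : ∀ x, IndepFun (fun ω t => M t ω) (fun ω t => S t ω) (P x))
    (ρ : EuclideanSpace ℝ (Fin d) → EuclideanSpace ℝ (Fin d) → ℝ)
    (hρ : Subordination.IsPolishMetric ρ)
    (p : ℝ) (hp : 1 ≤ p)
    (π : Measure (EuclideanSpace ℝ (Fin d))) (hπ : IsProbabilityMeasure π)
    (hinv : Subordination.IsInvariant M P π)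
    (Γ : EuclideanSpace ℝ (Fin d) → ℝ) (hΓ : ∀ x, 0 ≤ Γ x)
    (r : ℝ≥0 → ℝ) (hr : Measurable r) (hr1 : ∀ t, 1 ≤ r t)
    (hW : ∀ t x, Subordination.wasserstein ρ p
        (Subordination.semigroupAct M P (Measure.dirac x) t) π
      ≤ ENNReal.ofReal (Γ x) * ENNReal.ofReal (r t)) :
    -- the expectation defining `r_φ t` is the same under every `P y`
    ∃ rφ : ℝ≥0 → ℝ≥0∞,
      (∀ t y, rφ t = (∫⁻ ω, ENNReal.ofReal (r (S t ω)) ^ p ∂(P y)) ^ (1 / p)) ∧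
      ∀ t x, Subordination.wasserstein ρ p
          (Subordination.semigroupAct (Subordination.subordinate M S) P (Measure.dirac x) t) π
        ≤ ENNReal.ofReal (Γ x) * rφ t := by
  have hP := hM.isProbabilityMeasure
  have hp0 : 0 < p := by linarith
  have hrp : Measurable fun s => ENNReal.ofReal (r s) ^ p := hr.ennreal_ofReal.pow_const p
  have hrlaw (t : ℝ≥0) (y) : ∫⁻ ω, ENNReal.ofReal (r (S t ω)) ^ p ∂(P y) =
      ∫⁻ s, ENNReal.ofReal (r s) ^ p ∂((P y).map (S t)) :=
    (lintegral_map hrp ((hS y).measurable t)).symm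
  -- The starting point `0` is an arbitrary choice.
  refine ⟨fun t => (∫⁻ ω, ENNReal.ofReal (r (S t ω)) ^ p ∂(P 0)) ^ (1 / p), fun t y => ?_,
    fun t x => ?_⟩
  · beta_reduce
    rw [hrlaw, hrlaw, (hS 0).map_eq (hS y)]
  have hSt := (hS x).measurable t
  have hlaw : IsProbabilityMeasure ((P x).map (S t)) :=
    Measure.isProbabilityMeasure_map hSt.aemeasurable
  obtain ⟨κ, hκ, hκs, hκS⟩ := Subordination.exists_kernel_map_eval_indep (P x) M
    (fun t => (hM.adapted t).mono (ℱ.le t) le_rfl)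
    ((hM.cadlag x).mono fun ω hω t => (hω t).1) (S t) hSt
    ((hMS x).comp measurable_id (measurable_pi_apply t))
  rw [Subordination.semigroupAct_dirac]
  change Subordination.wasserstein ρ p ((P x).map fun ω => M (S t ω) ω) π ≤ _
  rw [hκS]
  refine (Subordination.wasserstein_bind_le hρ hp0 ((P x).map (S t)) κ π (fun s => Γ x * r s)
    (hr.const_mul _) (fun s => mul_nonneg (hΓ x) (zero_le_one.trans (hr1 s)))
    fun s => ?_).trans (le_of_eq ?_)
  · rw [hκs, ENNReal.ofReal_mul (hΓ x), ← Subordination.semigroupAct_dirac M P s x]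
    exact hW s x
  -- The factor `Γ x` leaves the integral even when the moment is infinite, by the convention `0 * ∞
  -- = 0` in `ℝ≥0∞`.
  · simp_rw [ENNReal.ofReal_mul (hΓ x), ENNReal.mul_rpow_of_nonneg _ _ hp0.le]
    rw [lintegral_const_mul _ hrp, ENNReal.mul_rpow_of_nonneg _ _ (by positivity),
      ← ENNReal.rpow_mul, mul_one_div_cancel hp0.ne', ENNReal.rpow_one, hrlaw,
      (hS x).map_eq (hS 0)]
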